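/- Consider a group-server queue: customers arrive according to a Poisson process with rate $\lambda>0$; there are $K$ groups of parallel servers, group $k$ having $M_k$ servers with exponential service times of rate $\mu_k>0$ and operating cost rate $c_k\ge 0$ per working server. The state $n\in\mathbb N$ is the number of customers in the system. The holding cost rate $h:\mathbb N\to\mathbb R$ is (weakly) increasing and convex, with $h(n)\to\infty$ as $n\to\infty$; turning servers on and off is free and customers can migrate freely between servers. An efficient stationary policy $d$ assigns to each state $n$ numbers $d(n,k)$ of working servers with $0\le d(n,k)\le M_k$ and $\sum_k d(n,k)\le n$; under $d$ the number of customers $n_t$ is the birth-death process with birth rate $\lambda$ and death rate $\sum_k d(n,k)\mu_k$ at state $n$. The policy has finite long-run average cost $\eta$ from an initial state $n_0$ if the expected cost rate $\mathbb E[h(n_t)+\sum_k d(n_t,k)c_k \mid n_0]$ is finite for every $t\ge 0$ and integrable over $[0,T]$ for every $T>0$, and $$\eta=\lim_{T\to\infty}\mathbb E\Big\{\frac1T\int_0^T\Big[h(n_t)+\sum_k d(n_t,k)\,c_k\Big]dt\,\Big|\,n_0\Big\}.$$ A policy is optimal in a class of efficient policies if it belongs to the class and, from every initial state, has a finite long-run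 average cost that does not exceed any finite long-run average cost, from that state, of a policy in the class. Let $d^*$ be optimal in the class of all efficient policies, and suppose that at some state $\bar n$ it turns on all servers of all groups: $d^*(\bar n,k)=M_k$ for all $k$. Then $d^*(n,k)=M_k$ for all $k$ and all $n\ge\bar n$. Consequently the search for an optimal policy can be truncated to the states $n<\bar n$: the class of efficient policies $d$ with $d(n,k)=M_k$ for all $k$ and all $n\ge\bar n$ is finite (and contains $d^*$), and every policy that is optimal in this class is optimal in the class of all efficient policies. -/

import Mathlib

open Filter Topology

/-- The data of a group-server queue with `K` groups: Poisson arrivals with rate `arrivalRate`;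
group `k` has `servers k` exponential servers, each of which, when it is on, works at rate
`serviceRate k` and costs `operatingCost k` per unit of time; `holdingCost n` is the cost rate of
having `n` customers in the system. -/
structure GroupServerQueue (K : ℕ) where
  arrivalRate : ℝ
  servers : Fin K → ℕ
  serviceRate : Fin K → ℝ
  operatingCost : Fin K → ℝ
  holdingCost : ℕ → ℝ

namespace GroupServerQueue

variable {K : ℕ} (Q : GroupServerQueue K)

/-- The efficient stationary policies: `d n k` is the number of working servers of group `k` when
there are `n` customers; at most `servers k` of them, and never more than `n` in total. -/
def efficientPolicies : Set (ℕ → Fin K → ℕ) :=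
  {d | ∀ n, (∀ k, d n k ≤ Q.servers k) ∧ ∑ k, d n k ≤ n}

/-- The efficient policies that turn on all servers at every state `n ≥ N`. -/
def truncatedPolicies (N : ℕ) : Set (ℕ → Fin K → ℕ) :=
  {d | d ∈ Q.efficientPolicies ∧ ∀ n, N ≤ n → ∀ k, d n k = Q.servers k}

/-- Total service rate of the action `m`. -/
noncomputable def totalRate (m : Fin K → ℕ) : ℝ := ∑ k, (m k : ℝ) * Q.serviceRate k

/-- Total cost rate at state `n` under the action `m`. -/
noncomputable def costRate (n : ℕ) (m : Fin K → ℕ) : ℝ :=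
  Q.holdingCost n + ∑ k, (m k : ℝ) * Q.operatingCost k

/-- Infinitesimal generator of the birth-death process of the number of customers under the
policy `d`. (An efficient policy has no working server at state `0`.) -/
noncomputable def generator (d : ℕ → Fin K → ℕ) (i j : ℕ) : ℝ :=
  if j = i + 1 then Q.arrivalRate
  else if i = j + 1 then Q.totalRate (d i)
  else if i = j then -(Q.arrivalRate + Q.totalRate (d i))
  else 0

/-- A bound for all the exit rates of all efficient policies. -/
noncomputable def uniformRate : ℝ := Q.arrivalRate + Q.totalRate Q.servers

/-- One-step matrix `U = I + B / Λ` of the chain uniformized at rate `Λ`, `B` the generator. -/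
noncomputable def uniformized (d : ℕ → Fin K → ℕ) (i j : ℕ) : ℝ :=
  (if i = j then 1 else 0) + Q.generator d i j / Q.uniformRate

/-- The powers of the matrix `U`; its `i`-th row vanishes outside `{0, …, i + 1}`. -/
noncomputable def uniformizedPow (d : ℕ → Fin K → ℕ) : ℕ → ℕ → ℕ → ℝ
  | 0, i, j => if i = j then 1 else 0
  | s + 1, i, j => ∑ l ∈ Finset.range (i + 2), Q.uniformized d i l * uniformizedPow d s l j

/-- Transition function `p_t(i, j) = P(n_t = j | n_0 = i)` of the continuous-time Markov process
with the (bounded) generator `B`, that is, `exp (t B) = ∑_s e^{-Λt} (Λt)^s / s! U^s`. That it is a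
probability for each `t ≥ 0` and `i`, starts at the identity and solves the Kolmogorov backward
equation for `B` is proved in `transition_nonneg`, `hasSum_transition`, `transition_zero`
and `hasDerivAt_transition`. -/
noncomputable def transition (d : ℕ → Fin K → ℕ) (t : ℝ) (i j : ℕ) : ℝ :=
  ∑' s : ℕ, Real.exp (-(Q.uniformRate * t)) * (Q.uniformRate * t) ^ s / (s.factorial : ℝ) *
    Q.uniformizedPow d s i j

/-- The expected cost rate `E (f (n_t, d (n_t)) | n_0 = n₀)` at time `t`. -/
noncomputable def expectedCostRate (d : ℕ → Fin K → ℕ) (n₀ : ℕ) (t : ℝ) : ℝ :=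
  ∑' m : ℕ, Q.transition d t n₀ m * Q.costRate m (d m)

/-- `η` is the (finite) long-run average cost of the policy `d` from the initial state `n₀`: all
the expectations are finite, and `η = lim_{T → ∞} (1 / T) E ∫₀ᵀ f (n_t, d (n_t)) dt`. -/
def HasAverageCost (d : ℕ → Fin K → ℕ) (n₀ : ℕ) (η : ℝ) : Prop :=
  (∀ t, 0 ≤ t → Summable fun m : ℕ => Q.transition d t n₀ m * Q.costRate m (d m)) ∧
  (∀ T, 0 < T → IntervalIntegrable (Q.expectedCostRate d n₀) MeasureTheory.volume 0 T) ∧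
  Tendsto (fun T : ℝ => (1 / T) * ∫ t in (0 : ℝ)..T, Q.expectedCostRate d n₀ t) atTop (𝓝 η)

/-- The policy `d` minimizes the long-run average cost over the class `D` of policies, from every
initial state, with a finite minimum. Policies whose average cost is infinite do not compete. -/
def IsOptimalIn (D : Set (ℕ → Fin K → ℕ)) (d : ℕ → Fin K → ℕ) : Prop :=
  d ∈ D ∧ ∀ n₀ : ℕ, ∃ η : ℝ, Q.HasAverageCost d n₀ η ∧
    ∀ d' ∈ D, ∀ η' : ℝ, Q.HasAverageCost d' n₀ η' → η ≤ η'

/-- Optimality among all efficient policies. -/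
def IsOptimal (d : ℕ → Fin K → ℕ) : Prop := Q.IsOptimalIn Q.efficientPolicies d

section Facts

variable {Q} {d : ℕ → Fin K → ℕ}

lemma totalRate_nonneg (hμ : ∀ k, 0 < Q.serviceRate k) (m : Fin K → ℕ) : 0 ≤ Q.totalRate m :=
  Finset.sum_nonneg fun k _ => mul_nonneg (Nat.cast_nonneg _) (hμ k).le

lemma uniformRate_pos (hl : 0 < Q.arrivalRate) (hμ : ∀ k, 0 < Q.serviceRate k) :
    0 < Q.uniformRate := by
  have := totalRate_nonneg hμ Q.servers
  unfold uniformRate; linarith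

lemma totalRate_zero (hd : d ∈ Q.efficientPolicies) : Q.totalRate (d 0) = 0 := by
  have h := (hd 0).2
  have h0 : ∀ k, d 0 k = 0 := fun k => by
    have := Finset.single_le_sum (f := d 0) (fun i _ => Nat.zero_le _) (Finset.mem_univ k)
    omega
  simp [totalRate, h0]

lemma totalRate_le (hμ : ∀ k, 0 < Q.serviceRate k) (hd : d ∈ Q.efficientPolicies) (n : ℕ) :
    Q.totalRate (d n) ≤ Q.totalRate Q.servers :=
  Finset.sum_le_sum fun k _ =>
    mul_le_mul_of_nonneg_right (by exact_mod_cast (hd n).1 k) (hμ k).le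

lemma generator_row_sum (hd : d ∈ Q.efficientPolicies) (i : ℕ) :
    ∑ l ∈ Finset.range (i + 2), Q.generator d i l = 0 := by
  rcases i with _ | i
  · simp [Finset.sum_range_succ, generator, totalRate_zero hd]
  · rw [Finset.sum_range_succ, Finset.sum_range_succ, Finset.sum_range_succ,
      Finset.sum_eq_zero]
    · simp [generator, show i ≠ i + 1 + 1 by omega]
    · intro l hl
      have := Finset.mem_range.1 hl
      unfold generator
      rw [if_neg (by omega), if_neg (by omega), if_neg (by omega)]

lemma uniformized_nonneg (hl : 0 < Q.arrivalRate) (hμ : ∀ k, 0 < Q.serviceRate k)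
    (hd : d ∈ Q.efficientPolicies) (i j : ℕ) : 0 ≤ Q.uniformized d i j := by
  have hΛ := uniformRate_pos hl hμ
  have h1 := totalRate_nonneg hμ (d i)
  have h2 := totalRate_le hμ hd i
  unfold uniformized generator
  split_ifs <;> try positivity
  rw [← div_self hΛ.ne', ← add_div]
  apply div_nonneg _ hΛ.le
  unfold uniformRate; linarith

lemma uniformized_row_sum (hd : d ∈ Q.efficientPolicies) (i : ℕ) :
    ∑ l ∈ Finset.range (i + 2), Q.uniformized d i l = 1 := by
  simp only [uniformized, Finset.sum_add_distrib, ← Finset.sum_div, generator_row_sum hd]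
  simp

lemma uniformizedPow_nonneg (hl : 0 < Q.arrivalRate) (hμ : ∀ k, 0 < Q.serviceRate k)
    (hd : d ∈ Q.efficientPolicies) (s i j : ℕ) : 0 ≤ Q.uniformizedPow d s i j := by
  induction s generalizing i with
  | zero => unfold uniformizedPow; split_ifs <;> norm_num
  | succ s ih =>
    unfold uniformizedPow
    exact Finset.sum_nonneg fun l _ => mul_nonneg (uniformized_nonneg hl hμ hd i l) (ih l)

lemma hasSum_uniformizedPow (hd : d ∈ Q.efficientPolicies) (s i : ℕ) :
    HasSum (Q.uniformizedPow d s i) 1 := by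
  induction s generalizing i with
  | zero =>
    have h : Q.uniformizedPow d 0 i = fun j => if j = i then (1 : ℝ) else 0 := by
      funext j; simp [uniformizedPow, eq_comm]
    rw [h]; exact hasSum_ite_eq i 1
  | succ s ih =>
    have := hasSum_sum (s := Finset.range (i + 2)) fun l _ => (ih l).mul_left (Q.uniformized d i l)
    simp only [mul_one, uniformized_row_sum hd] at this
    exact this

lemma uniformizedPow_le_one (hl : 0 < Q.arrivalRate) (hμ : ∀ k, 0 < Q.serviceRate k)
    (hd : d ∈ Q.efficientPolicies) (s i j : ℕ) : Q.uniformizedPow d s i j ≤ 1 :=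
  le_hasSum (hasSum_uniformizedPow hd s i) j fun l _ => uniformizedPow_nonneg hl hμ hd s i l

lemma summable_expSeries {a : ℕ → ℝ} (ha : ∀ s, |a s| ≤ 1) (x : ℝ) :
    Summable fun s : ℕ => x ^ s / (s.factorial : ℝ) * a s := by
  refine Summable.of_norm_bounded (Real.summable_pow_div_factorial |x|) fun s => ?_
  rw [Real.norm_eq_abs, abs_mul, abs_div, abs_pow, Nat.abs_cast]
  exact mul_le_of_le_one_right (by positivity) (ha s)

lemma hasDerivAt_expSeries {a : ℕ → ℝ} (ha : ∀ s, |a s| ≤ 1) (x : ℝ) :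
    HasDerivAt (fun y : ℝ => ∑' s : ℕ, y ^ s / (s.factorial : ℝ) * a s)
      (∑' s : ℕ, x ^ s / (s.factorial : ℝ) * a (s + 1)) x := by
  have hterm : ∀ (s : ℕ) (y : ℝ), HasDerivAt (fun y : ℝ => y ^ s / (s.factorial : ℝ) * a s)
      ((s : ℝ) * y ^ (s - 1) / (s.factorial : ℝ) * a s) y := fun s y =>
    ((hasDerivAt_pow s y).div_const _).mul_const _
  have hstep : ∀ (s : ℕ) (y : ℝ), ((s + 1 : ℕ) : ℝ) * y ^ (s + 1 - 1) / ((s + 1).factorial : ℝ) =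
      y ^ s / (s.factorial : ℝ) := fun s y => by
    rw [Nat.factorial_succ]; push_cast
    have : (s.factorial : ℝ) ≠ 0 := by positivity
    have : (s : ℝ) + 1 ≠ 0 := by positivity
    field_simp
  have hu : Summable fun s : ℕ => (s : ℝ) * (|x| + 1) ^ (s - 1) / (s.factorial : ℝ) := by
    rw [← summable_nat_add_iff 1]
    simp_rw [hstep]
    exact Real.summable_pow_div_factorial _
  have hmain := hasDerivAt_tsum_of_isPreconnected hu Metric.isOpen_ball
    (convex_ball (0 : ℝ) (|x| + 1)).isPreconnected
    (fun s y _ => hterm s y) (fun s y hy => ?_) (Metric.mem_ball_self (by positivity))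
    (summable_expSeries ha 0) (y := x) (by simp)
  · refine hmain.congr_deriv ?_
    have hs : Summable fun s : ℕ => (s : ℝ) * x ^ (s - 1) / (s.factorial : ℝ) * a s := by
      rw [← summable_nat_add_iff 1]
      simp_rw [hstep]
      exact summable_expSeries (fun s => ha (s + 1)) x
    rw [hs.tsum_eq_zero_add]
    simp_rw [hstep]
    simp
  · have hy' : |y| ≤ |x| + 1 := by simpa using (Metric.mem_ball.1 hy).le
    rw [Real.norm_eq_abs, abs_mul, abs_div, abs_mul, abs_pow, Nat.abs_cast, Nat.abs_cast]
    refine (mul_le_of_le_one_right (by positivity) (ha s)).trans ?_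
    gcongr

lemma abs_uniformizedPow_le (hl : 0 < Q.arrivalRate) (hμ : ∀ k, 0 < Q.serviceRate k)
    (hd : d ∈ Q.efficientPolicies) (s i j : ℕ) : |Q.uniformizedPow d s i j| ≤ 1 := by
  rw [abs_of_nonneg (uniformizedPow_nonneg hl hμ hd s i j)]
  exact uniformizedPow_le_one hl hμ hd s i j

lemma transition_eq (t : ℝ) (i j : ℕ) : Q.transition d t i j = Real.exp (-(Q.uniformRate * t)) *
    ∑' s : ℕ, (Q.uniformRate * t) ^ s / (s.factorial : ℝ) * Q.uniformizedPow d s i j := by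
  rw [transition, ← tsum_mul_left]
  exact tsum_congr fun s => by ring

theorem transition_zero (i j : ℕ) : Q.transition d 0 i j = if i = j then 1 else 0 := by
  rw [transition_eq, tsum_eq_single 0]
  · simp [uniformizedPow]
  · intro s hs; simp [hs]

theorem transition_nonneg (hl : 0 < Q.arrivalRate) (hμ : ∀ k, 0 < Q.serviceRate k)
    (hd : d ∈ Q.efficientPolicies) {t : ℝ} (ht : 0 ≤ t) (i j : ℕ) : 0 ≤ Q.transition d t i j := by
  have := uniformRate_pos hl hμ
  refine tsum_nonneg fun s => mul_nonneg (by positivity) (uniformizedPow_nonneg hl hμ hd s i j)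

theorem hasSum_transition (hl : 0 < Q.arrivalRate) (hμ : ∀ k, 0 < Q.serviceRate k)
    (hd : d ∈ Q.efficientPolicies) {t : ℝ} (ht : 0 ≤ t) (i : ℕ) :
    HasSum (Q.transition d t i) 1 := by
  have hΛ := uniformRate_pos hl hμ
  set x := Q.uniformRate * t with hx
  have hx0 : 0 ≤ x := by positivity
  have h0 : HasSum (fun s : ℕ => Real.exp (-x) * x ^ s / (s.factorial : ℝ)) 1 := by
    have h := (NormedSpace.expSeries_div_hasSum_exp x).mul_left (Real.exp (-x))
    rw [← Real.exp_eq_exp_ℝ, ← Real.exp_add, neg_add_cancel, Real.exp_zero] at h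
    simpa only [mul_div_assoc] using h
  have hnn : ∀ q : ℕ × ℕ, 0 ≤ Real.exp (-x) * x ^ q.1 / (q.1.factorial : ℝ) *
      Q.uniformizedPow d q.1 i q.2 := fun q =>
    mul_nonneg (by positivity) (uniformizedPow_nonneg hl hμ hd _ _ _)
  have hrow : ∀ s : ℕ, HasSum (fun j => Real.exp (-x) * x ^ s / (s.factorial : ℝ) *
      Q.uniformizedPow d s i j) (Real.exp (-x) * x ^ s / (s.factorial : ℝ)) := fun s => by
    simpa using (hasSum_uniformizedPow hd s i).mul_left (Real.exp (-x) * x ^ s / (s.factorial : ℝ))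
  have hsum : Summable fun q : ℕ × ℕ => Real.exp (-x) * x ^ q.1 / (q.1.factorial : ℝ) *
      Q.uniformizedPow d q.1 i q.2 := by
    rw [summable_prod_of_nonneg hnn]
    refine ⟨fun s => (hrow s).summable, ?_⟩
    simp_rw [fun s => (hrow s).tsum_eq]
    exact h0.summable
  have htot := hsum.hasSum
  have hval := (htot.prod_fiberwise hrow).unique h0
  rw [hval] at htot
  have hswap := (Equiv.prodComm ℕ ℕ).hasSum_iff.2 htot
  refine hswap.prod_fiberwise fun j => ?_
  exact (hswap.summable.prod_factor j).hasSum

theorem hasDerivAt_transition (hl : 0 < Q.arrivalRate) (hμ : ∀ k, 0 < Q.serviceRate k)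
    (hd : d ∈ Q.efficientPolicies) (t : ℝ) (i j : ℕ) :
    HasDerivAt (fun t => Q.transition d t i j)
      (∑ l ∈ Finset.range (i + 2), Q.generator d i l * Q.transition d t l j) t := by
  have hΛ := (uniformRate_pos hl hμ).ne'
  have hb := fun l s => abs_uniformizedPow_le hl hμ hd s l j
  have hlin : HasDerivAt (fun t : ℝ => Q.uniformRate * t) Q.uniformRate t := by
    simpa using (hasDerivAt_id t).const_mul Q.uniformRate
  have h1 := hlin.neg.exp.mul ((hasDerivAt_expSeries (hb i) (Q.uniformRate * t)).comp t hlin)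
  have hfun : (fun t => Q.transition d t i j) = fun t => Real.exp (-(Q.uniformRate * t)) *
      ∑' s : ℕ, (Q.uniformRate * t) ^ s / (s.factorial : ℝ) * Q.uniformizedPow d s i j :=
    funext fun t => transition_eq t i j
  rw [hfun]
  refine h1.congr_deriv ?_
  have hnext : ∑' s : ℕ, (Q.uniformRate * t) ^ s / (s.factorial : ℝ) *
      Q.uniformizedPow d (s + 1) i j = ∑ l ∈ Finset.range (i + 2), Q.uniformized d i l *
        ∑' s : ℕ, (Q.uniformRate * t) ^ s / (s.factorial : ℝ) * Q.uniformizedPow d s l j := by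
    simp_rw [← tsum_mul_left]
    rw [← Summable.tsum_finsetSum fun l _ => (summable_expSeries (hb l) _).mul_left _]
    refine tsum_congr fun s => ?_
    rw [uniformizedPow, Finset.mul_sum]
    exact Finset.sum_congr rfl fun l _ => by ring
  have hgen : ∀ l, Q.generator d i l =
      Q.uniformRate * (Q.uniformized d i l - if i = l then 1 else 0) := fun l => by
    rw [uniformized]; field_simp; ring
  simp only [Function.comp_apply, Pi.neg_apply]
  rw [hnext]
  simp_rw [hgen, transition_eq, mul_sub, sub_mul, Finset.sum_sub_distrib]
  have : ∀ F : ℕ → ℝ, ∑ l ∈ Finset.range (i + 2),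
      Q.uniformRate * (if i = l then 1 else 0) * F l = Q.uniformRate * F i := fun F => by
    simp
  rw [this]
  have h2 : ∀ F : ℕ → ℝ, ∑ l ∈ Finset.range (i + 2), Q.uniformRate * Q.uniformized d i l *
      (Real.exp (-(Q.uniformRate * t)) * F l) = Real.exp (-(Q.uniformRate * t)) *
      ((∑ l ∈ Finset.range (i + 2), Q.uniformized d i l * F l) * Q.uniformRate) := fun F => by
    rw [Finset.sum_mul, Finset.mul_sum]
    exact Finset.sum_congr rfl fun l _ => by ring
  rw [h2]
  ring

end Facts

end GroupServerQueue

/-! The proof turns optimality of long-run averages into a Bellman inequality and then argues by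
exchange. Let `f` be the cost rate under an optimal `d`. Time averages of the transition
probabilities have limit points in detailed balance, because the mean flux across each cut vanishes.
Since the holding cost diverges and the average cost is finite, no mass escapes, so `d` has a
stationary distribution `ν` that integrates `f` (`exists_isReversible`). Reversibility gives the
bound `p_t(i, j) ≤ ν j / ν i`, uniform in `t`. Dominated convergence then identifies the average
cost from a state charged by `ν` as `J = ∑ ν n * f n` (`IsReversible.hasAverageCost`).

Every state is charged (`IsOptimal.pos_stationary`). If the action is altered at a single state, the
new reversible measure is an explicit rescaling of `ν`, and optimality becomes a finite inequality:
at each `n ≥ 1` the action of `d` minimizes cost rate minus service rate times `G n`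
(`IsOptimal.action_le`). Here `G` is `valueDiff`, the difference of a solution of the Poisson
equation.

Above the total number of servers, `G` increases strictly (`IsOptimal.valueDiff_lt_succ`). One
failure of increase would propagate and drive `G` to `-∞`, whereas `G n ≥ 0` as soon as the holding
cost at `n` reaches `J`. If all servers are on at `N`, not gaining by switching one off gives `c_k ≤
μ_k * G N`. An idle server of group `k` at some `n > N` would give `μ_k * G n ≤ c_k`, contradicting
`G N < G n`. -/

namespace GroupServerQueue

variable {K : ℕ} {Q : GroupServerQueue K} {d : ℕ → Fin K → ℕ}

/-! ### Forward equation and regularity of the transition function. -/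

section Forward

lemma generator_eq_zero {i j : ℕ} (h : i + 1 < j ∨ j + 1 < i) : Q.generator d i j = 0 := by
  unfold generator
  rw [if_neg (by omega), if_neg (by omega), if_neg (by omega)]

lemma generator_succ (i : ℕ) : Q.generator d i (i + 1) = Q.arrivalRate := by
  simp [generator]

lemma generator_pred (i : ℕ) : Q.generator d (i + 1) i = Q.totalRate (d (i + 1)) := by
  simp [generator, show i ≠ i + 1 + 1 by omega]

lemma generator_self (i : ℕ) :
    Q.generator d i i = -(Q.arrivalRate + Q.totalRate (d i)) := by
  simp [generator]

lemma uniformized_eq_zero {i j : ℕ} (h : i + 1 < j ∨ j + 1 < i) : Q.uniformized d i j = 0 := by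
  rw [uniformized, generator_eq_zero h, if_neg (by omega)]; simp

/-- The recursive definition multiplies by `U` on the left. The forward equation and the symmetry of
powers need it on the right, where column `j` of the tridiagonal `U` bounds the sum. -/
lemma uniformizedPow_succ_right (s i j : ℕ) :
    Q.uniformizedPow d (s + 1) i j =
      ∑ l ∈ Finset.range (j + 2), Q.uniformizedPow d s i l * Q.uniformized d l j := by
  induction s generalizing i with
  | zero =>
    have h1 : Q.uniformizedPow d (0 + 1) i j = Q.uniformized d i j := by
      simp only [uniformizedPow, mul_ite, mul_one, mul_zero, Finset.sum_ite_eq', Finset.mem_range]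
      split_ifs with h
      · rfl
      · exact (uniformized_eq_zero (by omega)).symm
    rw [h1]
    simp only [uniformizedPow, ite_mul, one_mul, zero_mul, Finset.sum_ite_eq, Finset.mem_range]
    split_ifs with h
    · rfl
    · exact uniformized_eq_zero (by omega)
  | succ s ih =>
    rw [uniformizedPow]
    simp_rw [ih, Finset.mul_sum]
    rw [Finset.sum_comm]
    refine Finset.sum_congr rfl fun m _ => ?_
    rw [uniformizedPow, Finset.sum_mul]
    exact Finset.sum_congr rfl fun l _ => by ring

/-- The Kolmogorov forward equation. -/
theorem hasDerivAt_transition_forward (hl : 0 < Q.arrivalRate) (hμ : ∀ k, 0 < Q.serviceRate k)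
    (hd : d ∈ Q.efficientPolicies) (t : ℝ) (i j : ℕ) :
    HasDerivAt (fun t => Q.transition d t i j)
      (∑ l ∈ Finset.range (j + 2), Q.transition d t i l * Q.generator d l j) t := by
  have hΛ := (uniformRate_pos hl hμ).ne'
  have hb := fun l s => abs_uniformizedPow_le hl hμ hd s i l
  have hlin : HasDerivAt (fun t : ℝ => Q.uniformRate * t) Q.uniformRate t := by
    simpa using (hasDerivAt_id t).const_mul Q.uniformRate
  have h1 := hlin.neg.exp.mul ((hasDerivAt_expSeries (hb j) (Q.uniformRate * t)).comp t hlin)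
  have hfun : (fun t => Q.transition d t i j) = fun t => Real.exp (-(Q.uniformRate * t)) *
      ∑' s : ℕ, (Q.uniformRate * t) ^ s / (s.factorial : ℝ) * Q.uniformizedPow d s i j :=
    funext fun t => transition_eq t i j
  rw [hfun]
  refine h1.congr_deriv ?_
  have hnext : ∑' s : ℕ, (Q.uniformRate * t) ^ s / (s.factorial : ℝ) *
      Q.uniformizedPow d (s + 1) i j = ∑ l ∈ Finset.range (j + 2), Q.uniformized d l j *
        ∑' s : ℕ, (Q.uniformRate * t) ^ s / (s.factorial : ℝ) * Q.uniformizedPow d s i l := by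
    simp_rw [← tsum_mul_left]
    rw [← Summable.tsum_finsetSum fun l _ => (summable_expSeries (hb l) _).mul_left _]
    refine tsum_congr fun s => ?_
    rw [uniformizedPow_succ_right, Finset.mul_sum]
    exact Finset.sum_congr rfl fun l _ => by ring
  have hgen : ∀ l, Q.generator d l j =
      Q.uniformRate * Q.uniformized d l j - if l = j then Q.uniformRate else 0 := fun l => by
    rw [uniformized, mul_add, mul_div_cancel₀ _ hΛ]; split_ifs <;> ring
  simp only [Function.comp_apply, Pi.neg_apply]
  rw [hnext]
  simp_rw [hgen, transition_eq, mul_sub, Finset.sum_sub_distrib, mul_ite, mul_zero]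
  rw [Finset.sum_ite_eq', if_pos (by simp)]
  have h2 : ∀ F : ℕ → ℝ, ∑ l ∈ Finset.range (j + 2), Real.exp (-(Q.uniformRate * t)) * F l *
      (Q.uniformRate * Q.uniformized d l j) = Real.exp (-(Q.uniformRate * t)) *
      ((∑ l ∈ Finset.range (j + 2), Q.uniformized d l j * F l) * Q.uniformRate) := fun F => by
    rw [Finset.sum_mul, Finset.mul_sum]
    exact Finset.sum_congr rfl fun l _ => by ring
  rw [h2]
  ring

/-- Flows inside `{0, …, n}` cancel, leaving the net flux across the cut between `n` and `n + 1`. -/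
lemma sum_forward (hd : d ∈ Q.efficientPolicies) (x : ℕ → ℝ) (n : ℕ) :
    ∑ j ∈ Finset.range (n + 1), ∑ l ∈ Finset.range (j + 2), x l * Q.generator d l j =
      Q.totalRate (d (n + 1)) * x (n + 1) - Q.arrivalRate * x n := by
  induction n with
  | zero =>
    simp only [Finset.sum_range_succ, Finset.range_zero, Finset.sum_empty, zero_add,
      generator_self, totalRate_zero hd]
    rw [generator_pred 0]; ring_nf
  | succ n ih =>
    rw [Finset.sum_range_succ, ih, Finset.sum_range_succ, Finset.sum_range_succ,
      Finset.sum_range_succ, Finset.sum_eq_zero, generator_pred, generator_self, generator_succ]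
    · ring
    · intro l hl
      have := Finset.mem_range.1 hl
      rw [generator_eq_zero (by omega), mul_zero]

lemma continuous_transition (hl : 0 < Q.arrivalRate) (hμ : ∀ k, 0 < Q.serviceRate k)
    (hd : d ∈ Q.efficientPolicies) (i j : ℕ) : Continuous fun t => Q.transition d t i j :=
  continuous_iff_continuousAt.2 fun t =>
    (hasDerivAt_transition_forward hl hμ hd t i j).continuousAt

lemma sum_transition_le_one (hl : 0 < Q.arrivalRate) (hμ : ∀ k, 0 < Q.serviceRate k)
    (hd : d ∈ Q.efficientPolicies) {t : ℝ} (ht : 0 ≤ t) (i : ℕ) (s : Finset ℕ) :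
    ∑ j ∈ s, Q.transition d t i j ≤ 1 :=
  sum_le_hasSum s (fun j _ => transition_nonneg hl hμ hd ht i j) (hasSum_transition hl hμ hd ht i)

lemma transition_le_one (hl : 0 < Q.arrivalRate) (hμ : ∀ k, 0 < Q.serviceRate k)
    (hd : d ∈ Q.efficientPolicies) {t : ℝ} (ht : 0 ≤ t) (i j : ℕ) : Q.transition d t i j ≤ 1 := by
  simpa using sum_transition_le_one hl hμ hd ht i {j}

end Forward

/-! ### Time-averaged occupation measures and their limit points. -/

section Occupation

/-- Expected fraction of the time interval `[0, T]` spent in state `j`, starting from `i`. -/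
noncomputable def occupation (Q : GroupServerQueue K) (d : ℕ → Fin K → ℕ) (T : ℝ) (i j : ℕ) : ℝ :=
  (1 / T) * ∫ t in (0 : ℝ)..T, Q.transition d t i j

lemma sum_occupation_mul (hl : 0 < Q.arrivalRate) (hμ : ∀ k, 0 < Q.serviceRate k)
    (hd : d ∈ Q.efficientPolicies) (T : ℝ) (i : ℕ) (s : Finset ℕ) (g : ℕ → ℝ) :
    ∑ j ∈ s, Q.occupation d T i j * g j =
      (1 / T) * ∫ t in (0 : ℝ)..T, ∑ j ∈ s, Q.transition d t i j * g j := by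
  rw [intervalIntegral.integral_finsetSum fun j _ =>
    Continuous.intervalIntegrable (u := fun t => Q.transition d t i j * g j)
      ((continuous_transition hl hμ hd i j).mul continuous_const) _ _, Finset.mul_sum]
  refine Finset.sum_congr rfl fun j _ => ?_
  rw [intervalIntegral.integral_mul_const, occupation, mul_assoc]

lemma occupation_nonneg (hl : 0 < Q.arrivalRate) (hμ : ∀ k, 0 < Q.serviceRate k)
    (hd : d ∈ Q.efficientPolicies) {T : ℝ} (hT : 0 < T) (i j : ℕ) : 0 ≤ Q.occupation d T i j :=
  mul_nonneg (by positivity) (intervalIntegral.integral_nonneg hT.le fun t ht =>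
    transition_nonneg hl hμ hd ht.1 i j)

lemma average_le {u : ℝ → ℝ} {T c : ℝ} (hT : 0 < T)
    (hu : IntervalIntegrable u MeasureTheory.volume 0 T) (h : ∀ t ∈ Set.Icc 0 T, u t ≤ c) :
    (1 / T) * ∫ t in (0 : ℝ)..T, u t ≤ c := by
  have := intervalIntegral.integral_mono_on hT.le hu intervalIntegrable_const h
  rw [intervalIntegral.integral_const, smul_eq_mul, sub_zero] at this
  calc (1 / T) * ∫ t in (0 : ℝ)..T, u t ≤ (1 / T) * (T * c) := by gcongr
    _ = c := by field_simp

lemma sum_occupation_le_one (hl : 0 < Q.arrivalRate) (hμ : ∀ k, 0 < Q.serviceRate k)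
    (hd : d ∈ Q.efficientPolicies) {T : ℝ} (hT : 0 < T) (i : ℕ) (s : Finset ℕ) :
    ∑ j ∈ s, Q.occupation d T i j ≤ 1 := by
  have h := sum_occupation_mul hl hμ hd T i s fun _ => 1
  simp only [mul_one] at h
  rw [h]
  exact average_le hT ((continuous_finsetSum _ fun j _ =>
    continuous_transition hl hμ hd i j).intervalIntegrable _ _) fun t ht =>
      sum_transition_le_one hl hμ hd ht.1 i s

lemma occupation_le_one (hl : 0 < Q.arrivalRate) (hμ : ∀ k, 0 < Q.serviceRate k)
    (hd : d ∈ Q.efficientPolicies) {T : ℝ} (hT : 0 < T) (i j : ℕ) : Q.occupation d T i j ≤ 1 := by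
  simpa using sum_occupation_le_one hl hμ hd hT i {j}

/-- The flux across a cut is the derivative of the mass below it, so its time integral is the change
of that mass. This change is at most one in absolute value for `T ≥ 0`, hence the average flux is
`O(1 / T)`. -/
lemma occupation_flux (hl : 0 < Q.arrivalRate) (hμ : ∀ k, 0 < Q.serviceRate k)
    (hd : d ∈ Q.efficientPolicies) (T : ℝ) (i n : ℕ) :
    Q.totalRate (d (n + 1)) * Q.occupation d T i (n + 1) - Q.arrivalRate * Q.occupation d T i n =
      (1 / T) * (∑ j ∈ Finset.range (n + 1), Q.transition d T i j -
        ∑ j ∈ Finset.range (n + 1), Q.transition d 0 i j) := by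
  have hc := fun j => continuous_transition hl hμ hd i j
  have hint : ∀ (c : ℝ) (j : ℕ), IntervalIntegrable (fun t => c * Q.transition d t i j)
      MeasureTheory.volume 0 T := fun c j => (continuous_const.mul (hc j)).intervalIntegrable _ _
  have hderiv : ∀ t : ℝ, HasDerivAt (fun t => ∑ j ∈ Finset.range (n + 1), Q.transition d t i j)
      (Q.totalRate (d (n + 1)) * Q.transition d t i (n + 1) -
        Q.arrivalRate * Q.transition d t i n) t := fun t => by
    rw [← sum_forward hd]
    exact HasDerivAt.fun_sum fun j _ => hasDerivAt_transition_forward hl hμ hd t i j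
  rw [← intervalIntegral.integral_eq_sub_of_hasDerivAt (fun t _ => hderiv t)
    ((hint _ _).sub (hint _ _)), intervalIntegral.integral_sub (hint _ _) (hint _ _),
    intervalIntegral.integral_const_mul, intervalIntegral.integral_const_mul, occupation,
    occupation]
  ring

lemma tendsto_occupation_flux (hl : 0 < Q.arrivalRate) (hμ : ∀ k, 0 < Q.serviceRate k)
    (hd : d ∈ Q.efficientPolicies) (i n : ℕ) :
    Tendsto (fun T => Q.totalRate (d (n + 1)) * Q.occupation d T i (n + 1) -
      Q.arrivalRate * Q.occupation d T i n) atTop (𝓝 0) := by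
  refine squeeze_zero_norm' (a := fun T : ℝ => 1 / T) ?_ ?_
  · filter_upwards [eventually_gt_atTop 0] with T hT
    rw [occupation_flux hl hμ hd, norm_mul, Real.norm_of_nonneg (by positivity : 0 ≤ 1 / T)]
    refine mul_le_of_le_one_right (by positivity) ?_
    rw [Real.norm_eq_abs]
    exact abs_sub_le_of_nonneg_of_le
      (Finset.sum_nonneg fun j _ => transition_nonneg hl hμ hd hT.le i j)
      (sum_transition_le_one hl hμ hd hT.le i _)
      (Finset.sum_nonneg fun j _ => transition_nonneg hl hμ hd le_rfl i j)
      (sum_transition_le_one hl hμ hd le_rfl i _)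
  · simpa using tendsto_inv_atTop_zero (𝕜 := ℝ)

/-- Along an ultrafilter of times tending to infinity, the occupation measures converge pointwise
to a measure in detailed balance. -/
lemma exists_tendsto_occupation (hl : 0 < Q.arrivalRate) (hμ : ∀ k, 0 < Q.serviceRate k)
    (hd : d ∈ Q.efficientPolicies) (i : ℕ) (F : Ultrafilter ℝ) (hF : (F : Filter ℝ) ≤ atTop) :
    ∃ ν : ℕ → ℝ, (∀ n, Tendsto (fun T => Q.occupation d T i n) F (𝓝 (ν n))) ∧ (∀ n, 0 ≤ ν n) ∧
      ∀ n, Q.totalRate (d (n + 1)) * ν (n + 1) = Q.arrivalRate * ν n := by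
  have hpos : ∀ᶠ T in (F : Filter ℝ), 0 < T := hF (eventually_gt_atTop 0)
  have hlim : ∀ n, ∃ x ∈ Set.Icc (0 : ℝ) 1,
      Tendsto (fun T => Q.occupation d T i n) F (𝓝 x) := fun n => by
    refine isCompact_Icc.ultrafilter_le_nhds (F.map fun T => Q.occupation d T i n) ?_
    refine tendsto_principal.2 ?_
    filter_upwards [hpos] with T hT using
      ⟨occupation_nonneg hl hμ hd hT i n, occupation_le_one hl hμ hd hT i n⟩
  choose ν hν0 hν using hlim
  refine ⟨ν, hν, fun n => (hν0 n).1, fun n => ?_⟩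
  have h := ((hν (n + 1)).const_mul (Q.totalRate (d (n + 1)))).sub
    ((hν n).const_mul Q.arrivalRate)
  exact sub_eq_zero.1 (tendsto_nhds_unique h ((tendsto_occupation_flux hl hμ hd i n).mono_left hF))

end Occupation

/-! ### Detailed balance and symmetry of the transition function. -/

section Reversible

/-- A finite measure in detailed balance for the chain under `d` that integrates the cost rate. -/
structure IsReversible (Q : GroupServerQueue K) (d : ℕ → Fin K → ℕ) (ν : ℕ → ℝ) : Prop where
  nonneg : ∀ n, 0 ≤ ν n
  balance : ∀ n, Q.totalRate (d (n + 1)) * ν (n + 1) = Q.arrivalRate * ν n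
  summable : Summable ν
  summable_cost : Summable fun n => ν n * Q.costRate n (d n)

variable {ν : ℕ → ℝ}

lemma generator_symm (hν : ∀ n, Q.totalRate (d (n + 1)) * ν (n + 1) = Q.arrivalRate * ν n)
    (i j : ℕ) : ν i * Q.generator d i j = ν j * Q.generator d j i := by
  rcases lt_trichotomy i j with h | rfl | h
  · rcases (Nat.succ_le_of_lt h).eq_or_lt with rfl | h
    · rw [generator_succ, generator_pred]; linarith [hν i]
    · rw [generator_eq_zero (.inl h), generator_eq_zero (.inr h)]; simp
  · rfl
  · rcases (Nat.succ_le_of_lt h).eq_or_lt with rfl | h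
    · rw [generator_succ, generator_pred]; linarith [hν j]
    · rw [generator_eq_zero (.inl h), generator_eq_zero (.inr h)]; simp

lemma uniformizedPow_symm (hν : ∀ n, Q.totalRate (d (n + 1)) * ν (n + 1) = Q.arrivalRate * ν n)
    (s i j : ℕ) : ν i * Q.uniformizedPow d s i j = ν j * Q.uniformizedPow d s j i := by
  have h1 : ∀ i j, ν i * Q.uniformized d i j = ν j * Q.uniformized d j i := fun i j => by
    have := generator_symm hν i j
    rw [uniformized, uniformized, mul_add, mul_add, ← mul_div_assoc, ← mul_div_assoc, this]
    by_cases h : i = j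
    · simp [h]
    · rw [if_neg h, if_neg (Ne.symm h)]; simp
  induction s generalizing i with
  | zero =>
    by_cases h : i = j
    · simp [h]
    · simp [uniformizedPow, h, Ne.symm h]
  | succ s ih =>
    rw [uniformizedPow_succ_right s j i, uniformizedPow, Finset.mul_sum, Finset.mul_sum]
    refine Finset.sum_congr rfl fun l _ => ?_
    linear_combination Q.uniformizedPow d s l j * h1 i l + Q.uniformized d l i * ih l

lemma transition_symm (hν : ∀ n, Q.totalRate (d (n + 1)) * ν (n + 1) = Q.arrivalRate * ν n)
    (t : ℝ) (i j : ℕ) : ν i * Q.transition d t i j = ν j * Q.transition d t j i := by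
  rw [transition, transition, ← tsum_mul_left, ← tsum_mul_left]
  refine tsum_congr fun s => ?_
  rw [mul_left_comm, uniformizedPow_symm hν, mul_left_comm]

/-- By symmetry `ν i * p_t(i, j) = ν j * p_t(j, i) ≤ ν j`. The bound does not depend on `t` and
supplies the majorant for every later interchange of limits. -/
lemma transition_le_div (hl : 0 < Q.arrivalRate) (hμ : ∀ k, 0 < Q.serviceRate k)
    (hd : d ∈ Q.efficientPolicies)
    (hν : ∀ n, Q.totalRate (d (n + 1)) * ν (n + 1) = Q.arrivalRate * ν n)
    (hν0 : ∀ n, 0 ≤ ν n) {t : ℝ} (ht : 0 ≤ t) {i : ℕ} (hi : 0 < ν i) (j : ℕ) :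
    Q.transition d t i j ≤ ν j / ν i := by
  rw [le_div_iff₀' hi, transition_symm hν]
  exact mul_le_of_le_one_right (hν0 j) (transition_le_one hl hμ hd ht j i)

end Reversible

/-! ### Average cost as a stationary mean. -/

section AverageCost

lemma holdingCost_le_costRate (hc : ∀ k, 0 ≤ Q.operatingCost k) (n : ℕ) (m : Fin K → ℕ) :
    Q.holdingCost n ≤ Q.costRate n m :=
  le_add_of_nonneg_right (Finset.sum_nonneg fun k _ => mul_nonneg (Nat.cast_nonneg _) (hc k))

/-- All states from `N` on cost at least `holdingCost N`, so the discarded terms are nonnegative.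
Subtracting this constant leaves a finite sum, which passes to limits without domination. -/
lemma sum_transition_le_expectedCostRate (hl : 0 < Q.arrivalRate)
    (hμ : ∀ k, 0 < Q.serviceRate k) (hc : ∀ k, 0 ≤ Q.operatingCost k)
    (hm : Monotone Q.holdingCost) (hd : d ∈ Q.efficientPolicies) {t : ℝ} (ht : 0 ≤ t) (i : ℕ)
    (hs : Summable fun m : ℕ => Q.transition d t i m * Q.costRate m (d m)) (N : ℕ) :
    ∑ n ∈ Finset.range N, Q.transition d t i n * (Q.costRate n (d n) - Q.holdingCost N) ≤
      Q.expectedCostRate d i t - Q.holdingCost N := by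
  have h1 := hs.hasSum.sub ((hasSum_transition hl hμ hd ht i).mul_right (Q.holdingCost N))
  simp_rw [one_mul, ← mul_sub] at h1
  refine sum_le_hasSum _ (fun n hn => ?_) h1
  refine mul_nonneg (transition_nonneg hl hμ hd ht i n) (sub_nonneg.2 ?_)
  exact (hm (by simpa using hn)).trans (holdingCost_le_costRate hc n _)

lemma sum_occupation_le_average (hl : 0 < Q.arrivalRate)
    (hμ : ∀ k, 0 < Q.serviceRate k) (hc : ∀ k, 0 ≤ Q.operatingCost k)
    (hm : Monotone Q.holdingCost) (hd : d ∈ Q.efficientPolicies) {i : ℕ}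
    (hs : ∀ t, 0 ≤ t → Summable fun m : ℕ => Q.transition d t i m * Q.costRate m (d m))
    {T : ℝ} (hT : 0 < T)
    (hint : IntervalIntegrable (Q.expectedCostRate d i) MeasureTheory.volume 0 T) (N : ℕ) :
    ∑ n ∈ Finset.range N, Q.occupation d T i n * (Q.costRate n (d n) - Q.holdingCost N) ≤
      (1 / T) * (∫ t in (0 : ℝ)..T, Q.expectedCostRate d i t) - Q.holdingCost N := by
  rw [sum_occupation_mul hl hμ hd]
  have h := intervalIntegral.integral_mono_on hT.le
    (Continuous.intervalIntegrable (u := fun t => ∑ n ∈ Finset.range N,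
      Q.transition d t i n * (Q.costRate n (d n) - Q.holdingCost N))
      (continuous_finsetSum _ fun n _ =>
        (continuous_transition hl hμ hd i n).mul continuous_const) 0 T)
    (hint.sub (intervalIntegrable_const (c := Q.holdingCost N))) fun t ht =>
      sum_transition_le_expectedCostRate hl hμ hc hm hd ht.1 i (hs t ht.1) N
  rw [intervalIntegral.integral_sub hint intervalIntegrable_const,
    intervalIntegral.integral_const, smul_eq_mul, sub_zero] at h
  refine (mul_le_mul_of_nonneg_left h (by positivity : 0 ≤ 1 / T)).trans_eq ?_
  field_simp

/-- A policy with a finite average cost has a stationary distribution that integrates the cost. -/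
theorem exists_isReversible (hl : 0 < Q.arrivalRate)
    (hμ : ∀ k, 0 < Q.serviceRate k) (hc : ∀ k, 0 ≤ Q.operatingCost k)
    (hm : Monotone Q.holdingCost) (hinf : Tendsto Q.holdingCost atTop atTop)
    (hd : d ∈ Q.efficientPolicies) {i : ℕ} {η : ℝ} (hη : Q.HasAverageCost d i η) :
    ∃ ν, Q.IsReversible d ν ∧ HasSum ν 1 := by
  obtain ⟨hs, hint, hlim⟩ := hη
  have hF : (Ultrafilter.of (atTop : Filter ℝ) : Filter ℝ) ≤ atTop := Ultrafilter.of_le _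
  generalize Ultrafilter.of (atTop : Filter ℝ) = F at hF
  have hpos : ∀ᶠ T in (F : Filter ℝ), 0 < T := hF (eventually_gt_atTop 0)
  obtain ⟨ν, hν, hν0, hbal⟩ := exists_tendsto_occupation hl hμ hd i F hF
  have hle1 : ∀ N, ∑ n ∈ Finset.range N, ν n ≤ 1 := fun N =>
    le_of_tendsto (tendsto_finsetSum _ fun n _ => hν n)
      (hpos.mono fun T hT => sum_occupation_le_one hl hμ hd hT i _)
  have hcost : ∀ N, ∑ n ∈ Finset.range N, ν n * (Q.costRate n (d n) - Q.holdingCost N) ≤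
      η - Q.holdingCost N := fun N =>
    le_of_tendsto_of_tendsto (tendsto_finsetSum _ fun n _ => (hν n).mul_const _)
      ((hlim.mono_left hF).sub_const _)
      (hpos.mono fun T hT => sum_occupation_le_average hl hμ hc hm hd hs hT (hint T hT) N)
  set b := Q.holdingCost 0 with hb
  -- Both summands are nonnegative: bounding the first gives integrability of the cost, bounding the
  -- second excludes loss of mass.
  have hkey : ∀ N, ∑ n ∈ Finset.range N, ν n * (Q.costRate n (d n) - b) +
      (Q.holdingCost N - b) * (1 - ∑ n ∈ Finset.range N, ν n) ≤ η - b := fun N => by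
    have h := hcost N
    simp_rw [mul_sub, Finset.sum_sub_distrib, ← Finset.sum_mul] at h ⊢
    linarith
  have hfb : ∀ n, 0 ≤ ν n * (Q.costRate n (d n) - b) := fun n =>
    mul_nonneg (hν0 n) (sub_nonneg.2 ((hm (Nat.zero_le n)).trans (holdingCost_le_costRate hc n _)))
  have hNb : ∀ N, 0 ≤ Q.holdingCost N - b := fun N => sub_nonneg.2 (hm (Nat.zero_le N))
  have hsum : Summable ν := summable_of_sum_range_le hν0 hle1
  have hsumf : Summable fun n => ν n * (Q.costRate n (d n) - b) :=
    summable_of_sum_range_le (c := η - b) hfb fun N => by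
      have := mul_nonneg (hNb N) (sub_nonneg.2 (hle1 N))
      linarith [hkey N]
  refine ⟨ν, ⟨hν0, hbal, hsum, ?_⟩, ?_⟩
  · refine (hsumf.add (hsum.mul_right b)).congr fun n => ?_
    ring
  · have htot : ∑' n, ν n = 1 := by
      refine le_antisymm (hsum.tsum_le_of_sum_range_le hle1) ?_
      by_contra! hlt
      -- Missing mass would sit beyond every `N` and cost at least `holdingCost N`, more than `η`
      -- allows.
      have hunb : Tendsto (fun N => (Q.holdingCost N - b) * (1 - ∑' n, ν n)) atTop atTop :=
        (tendsto_atTop_add_const_right _ _ hinf).atTop_mul_const (sub_pos.2 hlt)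
      obtain ⟨N, hN⟩ := (hunb.eventually_gt_atTop (η - b)).exists
      have h1 : (Q.holdingCost N - b) * (1 - ∑' n, ν n) ≤
          (Q.holdingCost N - b) * (1 - ∑ n ∈ Finset.range N, ν n) :=
        mul_le_mul_of_nonneg_left (sub_le_sub_left
          (hsum.sum_le_tsum _ fun n _ => hν0 n) _) (hNb N)
      have h2 := Finset.sum_nonneg fun n (_ : n ∈ Finset.range N) => hfb n
      linarith [hkey N]
    exact htot ▸ hsum.hasSum

lemma balance_pos (hl : 0 < Q.arrivalRate) {ν : ℕ → ℝ} (hν0 : ∀ n, 0 ≤ ν n)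
    (hν : ∀ n, Q.totalRate (d (n + 1)) * ν (n + 1) = Q.arrivalRate * ν n)
    {i n : ℕ} (hin : i ≤ n) (hi : 0 < ν i) : 0 < ν n := by
  induction n, hin using Nat.le_induction with
  | base => exact hi
  | succ n _ ih =>
    refine (hν0 _).lt_of_ne' fun h => ?_
    have := hν n
    rw [h, mul_zero] at this
    exact (mul_pos hl ih).ne this

/-- Measures in detailed balance are unique up to a factor among those absolutely continuous with
respect to a given one. -/
lemma balance_unique (hl : 0 < Q.arrivalRate) {ν π : ℕ → ℝ} (hν0 : ∀ n, 0 ≤ ν n)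
    (hν : ∀ n, Q.totalRate (d (n + 1)) * ν (n + 1) = Q.arrivalRate * ν n)
    (hπ : ∀ n, Q.totalRate (d (n + 1)) * π (n + 1) = Q.arrivalRate * π n)
    (hac : ∀ n, ν n = 0 → π n = 0) {i : ℕ} (hi : 0 < ν i) (n : ℕ) :
    π n * ν i = π i * ν n := by
  -- Eliminating the death rate, which may be zero, leaves a relation between the two measures
  -- alone.
  have hcross : ∀ n, π n * ν (n + 1) = π (n + 1) * ν n := fun n =>
    mul_left_cancel₀ hl.ne' (by linear_combination π (n + 1) * hν n - ν (n + 1) * hπ n)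
  rcases le_total i n with h | h
  · induction n, h using Nat.le_induction with
    | base => rfl
    | succ n hn ih =>
      refine mul_left_cancel₀ (balance_pos hl hν0 hν hn hi).ne' ?_
      linear_combination ν (n + 1) * ih - ν i * hcross n
  · induction h using Nat.decreasingInduction with
    | self => rfl
    | of_succ n hn ih =>
      rcases (hν0 n).eq_or_lt' with h0 | hpos
      · rw [h0, hac n h0]; ring
      · refine mul_left_cancel₀ (balance_pos hl hν0 hν (Nat.le_succ n) hpos).ne' ?_
        linear_combination ν n * ih + ν i * hcross n

variable {ν : ℕ → ℝ}

lemma norm_transition_mul_le (hl : 0 < Q.arrivalRate) (hμ : ∀ k, 0 < Q.serviceRate k)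
    (hd : d ∈ Q.efficientPolicies) (hν : Q.IsReversible d ν) {i : ℕ} (hi : 0 < ν i) (g : ℕ → ℝ)
    {t : ℝ} (ht : 0 ≤ t) (n : ℕ) : ‖Q.transition d t i n * g n‖ ≤ ‖ν n * g n‖ / ν i := by
  rw [norm_mul, norm_mul, mul_div_right_comm, Real.norm_of_nonneg (hν.nonneg n),
    Real.norm_of_nonneg (transition_nonneg hl hμ hd ht i n)]
  exact mul_le_mul_of_nonneg_right
    (transition_le_div hl hμ hd hν.balance hν.nonneg ht hi n) (norm_nonneg _)

lemma hasSum_occupation_mul (hl : 0 < Q.arrivalRate) (hμ : ∀ k, 0 < Q.serviceRate k)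
    (hd : d ∈ Q.efficientPolicies) (hν : Q.IsReversible d ν) {i : ℕ} (hi : 0 < ν i) {g : ℕ → ℝ}
    (hg : Summable fun n => ν n * g n) {T : ℝ} (hT : 0 < T) :
    HasSum (fun n => Q.occupation d T i n * g n)
      ((1 / T) * ∫ t in (0 : ℝ)..T, ∑' n, Q.transition d t i n * g n) := by
  have hnonneg : ∀ t ∈ Set.uIoc 0 T, 0 ≤ t := fun t ht => by
    rw [Set.uIoc_of_le hT.le] at ht; exact ht.1.le
  have hb : Summable fun n => ‖ν n * g n‖ / ν i := hg.norm.div_const _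
  have h := intervalIntegral.hasSum_integral_of_dominated_convergence
    (μ := MeasureTheory.volume) (a := 0) (b := T)
    (F := fun n t => Q.transition d t i n * g n) (f := fun t => ∑' n, Q.transition d t i n * g n)
    (fun n _ => ‖ν n * g n‖ / ν i)
    (fun n => ((continuous_transition hl hμ hd i n).mul continuous_const).aestronglyMeasurable)
    (fun n => .of_forall fun t ht =>
      norm_transition_mul_le hl hμ hd hν hi g (hnonneg t ht) n)
    (.of_forall fun _ _ => hb) intervalIntegrable_const
    (.of_forall fun t ht => (Summable.of_norm_bounded hb fun n =>
      norm_transition_mul_le hl hμ hd hν hi g (hnonneg t ht) n).hasSum)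
  refine (h.mul_left (1 / T)).congr_fun fun n => ?_
  simp only [intervalIntegral.integral_mul_const, occupation, mul_assoc]

lemma occupation_le_div (hl : 0 < Q.arrivalRate) (hμ : ∀ k, 0 < Q.serviceRate k)
    (hd : d ∈ Q.efficientPolicies) (hν : Q.IsReversible d ν) {i : ℕ} (hi : 0 < ν i)
    {T : ℝ} (hT : 0 < T) (n : ℕ) : Q.occupation d T i n ≤ ν n / ν i :=
  average_le hT ((continuous_transition hl hμ hd i n).intervalIntegrable _ _) fun _ ht =>
    transition_le_div hl hμ hd hν.balance hν.nonneg ht.1 hi n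

lemma norm_occupation_mul_le (hl : 0 < Q.arrivalRate) (hμ : ∀ k, 0 < Q.serviceRate k)
    (hd : d ∈ Q.efficientPolicies) (hν : Q.IsReversible d ν) {i : ℕ} (hi : 0 < ν i) (g : ℕ → ℝ)
    {T : ℝ} (hT : 0 < T) (n : ℕ) : ‖Q.occupation d T i n * g n‖ ≤ ‖ν n * g n‖ / ν i := by
  rw [norm_mul, norm_mul, mul_div_right_comm, Real.norm_of_nonneg (hν.nonneg n),
    Real.norm_of_nonneg (occupation_nonneg hl hμ hd hT i n)]
  exact mul_le_mul_of_nonneg_right (occupation_le_div hl hμ hd hν hi hT n) (norm_nonneg _)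

/-- Every ultrafilter limit is in detailed balance and dominated by `ν / ν i`, so it keeps mass one
and vanishes where `ν` does. Uniqueness then forces it to be `ν`. -/
lemma tendsto_occupation (hl : 0 < Q.arrivalRate) (hμ : ∀ k, 0 < Q.serviceRate k)
    (hd : d ∈ Q.efficientPolicies) (hν : Q.IsReversible d ν) (h1 : HasSum ν 1) {i : ℕ}
    (hi : 0 < ν i) (n : ℕ) : Tendsto (fun T => Q.occupation d T i n) atTop (𝓝 (ν n)) := by
  rw [tendsto_iff_ultrafilter]
  intro F hF
  have hpos : ∀ᶠ T in (F : Filter ℝ), 0 < T := hF (eventually_gt_atTop 0)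
  obtain ⟨π, hπ, hπ0, hbal⟩ := exists_tendsto_occupation hl hμ hd i F hF
  have hle : ∀ n, π n ≤ ν n / ν i := fun n =>
    le_of_tendsto (hπ n) (hpos.mono fun T hT => occupation_le_div hl hμ hd hν hi hT n)
  have hsum : Summable π :=
    Summable.of_nonneg_of_le hπ0 hle (hν.summable.div_const _)
  have htot : ∑' n, π n = 1 := by
    refine tendsto_nhds_unique (tendsto_tsum_of_dominated_convergence
      (hν.summable.div_const (ν i)) hπ (hpos.mono fun T hT n => ?_))
      (tendsto_const_nhds.congr' (hpos.mono fun T hT => ?_))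
    · rw [Real.norm_of_nonneg (occupation_nonneg hl hμ hd hT i n)]
      exact occupation_le_div hl hμ hd hν hi hT n
    · have h := hasSum_occupation_mul hl hμ hd hν hi (g := fun _ => 1)
        (by simpa using hν.summable) hT
      simp only [mul_one] at h
      dsimp only
      rw [h.tsum_eq, intervalIntegral.integral_congr (g := fun _ => (1 : ℝ)) fun t ht => ?_]
      · rw [intervalIntegral.integral_const, smul_eq_mul, sub_zero]
        field_simp
      · rw [Set.uIcc_of_le hT.le] at ht
        exact (hasSum_transition hl hμ hd ht.1 i).tsum_eq
  have huniq := balance_unique hl hν.nonneg hν.balance hbal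
    (fun n h0 => le_antisymm (by simpa [h0] using hle n) (hπ0 n)) hi
  have hπi : ν i = π i := by
    have h := (htot ▸ hsum.hasSum).mul_right (ν i)
    simp_rw [huniq] at h
    simpa using h.unique (h1.mul_left (π i))
  have : π n = ν n := mul_right_cancel₀ hi.ne' (by rw [huniq, ← hπi, mul_comm])
  exact this ▸ hπ n

/-- The ergodic theorem: the average cost is the mean of the cost rate under the stationary
distribution. -/
theorem IsReversible.hasAverageCost (hl : 0 < Q.arrivalRate) (hμ : ∀ k, 0 < Q.serviceRate k)
    (hd : d ∈ Q.efficientPolicies) (hν : Q.IsReversible d ν) (h1 : HasSum ν 1) {i : ℕ}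
    (hi : 0 < ν i) : Q.HasAverageCost d i (∑' n, ν n * Q.costRate n (d n)) := by
  have hb : Summable fun n => ‖ν n * Q.costRate n (d n)‖ / ν i :=
    hν.summable_cost.norm.div_const _
  refine ⟨fun t ht => Summable.of_norm_bounded hb fun n =>
    norm_transition_mul_le hl hμ hd hν hi (fun n => Q.costRate n (d n)) ht n, fun T hT => ?_, ?_⟩
  · refine ContinuousOn.intervalIntegrable_of_Icc hT.le ?_
    exact continuousOn_tsum (fun n =>
      ((continuous_transition hl hμ hd i n).mul continuous_const).continuousOn) hb
      fun n t ht => norm_transition_mul_le hl hμ hd hν hi (fun n => Q.costRate n (d n)) ht.1 n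
  · refine (tendsto_tsum_of_dominated_convergence hb
      (fun n => (tendsto_occupation hl hμ hd hν h1 hi n).mul_const _)
      ((eventually_gt_atTop 0).mono fun T hT n =>
        norm_occupation_mul_le hl hμ hd hν hi (fun n => Q.costRate n (d n)) hT n)).congr' ?_
    filter_upwards [eventually_gt_atTop 0] with T hT
    exact (hasSum_occupation_mul hl hμ hd hν hi hν.summable_cost hT).tsum_eq

lemma IsReversible.smul (hν : Q.IsReversible d ν) {a : ℝ} (ha : 0 ≤ a) :
    Q.IsReversible d fun n => a * ν n where
  nonneg n := mul_nonneg ha (hν.nonneg n)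
  balance n := by linear_combination a * hν.balance n
  summable := hν.summable.mul_left a
  summable_cost := (hν.summable_cost.mul_left a).congr fun n => by ring

/-- Under the optimal policy with stationary distribution `ν`, no other policy has a negative mean
excess cost under its reversible measures. -/
theorem IsOptimal.excess_nonneg (hl : 0 < Q.arrivalRate) (hμ : ∀ k, 0 < Q.serviceRate k)
    (hopt : Q.IsOptimal d) (hν : Q.IsReversible d ν) (h1 : HasSum ν 1) {i : ℕ} (hi : 0 < ν i)
    {d' : ℕ → Fin K → ℕ} (hd' : d' ∈ Q.efficientPolicies) {π : ℕ → ℝ} (hπ : Q.IsReversible d' π)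
    (hi' : 0 < π i) :
    0 ≤ ∑' n, π n * (Q.costRate n (d' n) - ∑' n, ν n * Q.costRate n (d n)) := by
  obtain ⟨η, hη, hmin⟩ := hopt.2 i
  have hS : 0 < ∑' n, π n := hπ.summable.tsum_pos hπ.nonneg i hi'
  have hη' := (hπ.smul (inv_nonneg.2 hS.le)).hasAverageCost hl hμ hd'
    (by simpa [hS.ne'] using hπ.summable.hasSum.mul_left (∑' n, π n)⁻¹) (i := i) (by positivity)
  have hle := hmin d' hd' _ hη'
  rw [tendsto_nhds_unique hη.2.2 (hν.hasAverageCost hl hμ hopt.1 h1 hi).2.2] at hle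
  simp_rw [mul_assoc, tsum_mul_left] at hle
  rw [inv_mul_eq_div, le_div_iff₀ hS] at hle
  simp_rw [mul_sub]
  rw [hπ.summable_cost.tsum_sub (hπ.summable.mul_right _), tsum_mul_right]
  linarith

end AverageCost

/-! ### Changing finitely many actions, and recurrence of all states. -/

section Improvement

variable {ν : ℕ → ℝ}

lemma hasSum_of_eq_of_le {g g' : ℕ → ℝ} {a : ℝ} (hg : HasSum g a) (N : ℕ)
    (h : ∀ n, N ≤ n → g' n = g n) :
    HasSum g' (a + ∑ n ∈ Finset.range N, (g' n - g n)) := by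
  have h0 : HasSum (fun n => g' n - g n) (∑ n ∈ Finset.range N, (g' n - g n)) :=
    hasSum_sum_of_ne_finset_zero fun n hn => by rw [h n (by simpa using hn), sub_self]
  exact (hg.add h0).congr_fun fun n => by ring

lemma summable_of_eq_of_le {g g' : ℕ → ℝ} (hg : Summable g) (N : ℕ)
    (h : ∀ n, N ≤ n → g' n = g n) : Summable g' :=
  (hasSum_of_eq_of_le hg.hasSum N h).summable

lemma sum_update_mul (m : Fin K → ℕ) (k : Fin K) (x : ℕ) (w : Fin K → ℝ) :
    ∑ j, (Function.update m k x j : ℝ) * w j = ∑ j, (m j : ℝ) * w j + ((x : ℝ) - m k) * w k := by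
  rw [← sub_eq_iff_eq_add', ← Finset.sum_sub_distrib, Finset.sum_eq_single k]
  · rw [Function.update_self]; ring
  · intro j _ hj
    rw [Function.update_of_ne hj, sub_self]
  · simp

lemma totalRate_update (m : Fin K → ℕ) (k : Fin K) (x : ℕ) :
    Q.totalRate (Function.update m k x) =
      Q.totalRate m + ((x : ℝ) - m k) * Q.serviceRate k :=
  sum_update_mul m k x Q.serviceRate

lemma costRate_update (n : ℕ) (m : Fin K → ℕ) (k : Fin K) (x : ℕ) :
    Q.costRate n (Function.update m k x) =
      Q.costRate n m + ((x : ℝ) - m k) * Q.operatingCost k := by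
  rw [costRate, costRate, sum_update_mul]; ring

lemma eq_zero_of_totalRate_eq_zero (hμ : ∀ k, 0 < Q.serviceRate k) {m : Fin K → ℕ}
    (h : Q.totalRate m = 0) : m = 0 := by
  funext k
  have h1 := (Finset.sum_eq_zero_iff_of_nonneg fun k _ =>
    mul_nonneg (Nat.cast_nonneg (m k)) (hμ k).le).1 h k (Finset.mem_univ k)
  simpa [(hμ k).ne'] using h1

/-- The work conservation law. -/
lemma hasSum_totalRate (hd : d ∈ Q.efficientPolicies) (hν : Q.IsReversible d ν)
    (h1 : HasSum ν 1) : HasSum (fun n => Q.totalRate (d n) * ν n) Q.arrivalRate := by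
  have h := h1.mul_left Q.arrivalRate
  simp_rw [← hν.balance] at h
  simpa [totalRate_zero hd] using (hasSum_nat_add_iff (f := fun n => Q.totalRate (d n) * ν n) 1).1 h

/-- Take the least ratio of cost to service rate among the nonempty groups; empty groups contribute
nothing to a feasible action. -/
lemma exists_cheapest (hμ : ∀ k, 0 < Q.serviceRate k) (hs : ∃ k, 0 < Q.servers k) :
    ∃ k₀, 0 < Q.servers k₀ ∧ ∀ m : Fin K → ℕ, (∀ k, m k ≤ Q.servers k) →
      Q.operatingCost k₀ / Q.serviceRate k₀ * Q.totalRate m ≤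
        ∑ k, (m k : ℝ) * Q.operatingCost k := by
  obtain ⟨k₁, hk₁⟩ := hs
  obtain ⟨k₀, hk₀, hmin⟩ := Finset.exists_min_image
    (Finset.univ.filter fun k => 0 < Q.servers k)
    (fun k => Q.operatingCost k / Q.serviceRate k) ⟨k₁, by simpa using hk₁⟩
  refine ⟨k₀, by simpa using hk₀, fun m hm => ?_⟩
  rw [totalRate, Finset.mul_sum]
  refine Finset.sum_le_sum fun k _ => ?_
  rcases (m k).eq_zero_or_pos with h | h
  · simp [h]
  · have h2 := hmin k (by simpa using h.trans_le (hm k))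
    rw [le_div_iff₀ (hμ k)] at h2
    rw [mul_left_comm]
    exact mul_le_mul_of_nonneg_left h2 (Nat.cast_nonneg _)

/-- Under an optimal policy every state is recurrent: it does not pay to leave all servers idle
when there are customers. -/
theorem IsOptimal.pos_stationary (hl : 0 < Q.arrivalRate) (hμ : ∀ k, 0 < Q.serviceRate k)
    (hm : Monotone Q.holdingCost) (hinf : Tendsto Q.holdingCost atTop atTop)
    (hopt : Q.IsOptimal d) (hν : Q.IsReversible d ν) (h1 : HasSum ν 1) (n : ℕ) : 0 < ν n := by
  classical
  refine balance_pos hl hν.nonneg hν.balance (Nat.zero_le n) ?_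
  have hex : ∃ n, 0 < ν n := by
    by_contra! h
    have h0 : ν = fun _ => 0 := funext fun n => le_antisymm (h n) (hν.nonneg n)
    rw [h0] at h1
    exact zero_ne_one (hasSum_zero.unique h1)
  obtain ⟨b, hb, hbmin⟩ : ∃ b, 0 < ν b ∧ ∀ n, n < b → ν n = 0 :=
    ⟨Nat.find hex, Nat.find_spec hex, fun n hn =>
      le_antisymm (not_lt.1 (Nat.find_min hex hn)) (hν.nonneg n)⟩
  rcases b with _ | b
  · exact hb
  exfalso
  -- `b + 1` is the least charged state, so nothing may flow down from it.
  have hdb : d (b + 1) = 0 := eq_zero_of_totalRate_eq_zero hμ (by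
    have := hν.balance b
    rw [hbmin b (Nat.lt_succ_self b), mul_zero] at this
    exact (mul_eq_zero.1 this).resolve_right hb.ne')
  -- Balance between `b + 1` and `b + 2` needs a positive death rate at `b + 2`.
  have hserv : ∃ k, 0 < Q.servers k := by
    by_contra! h
    have h2 : Q.totalRate (d (b + 1 + 1)) = 0 := Finset.sum_eq_zero fun k _ => by
      have := (hopt.1 (b + 1 + 1)).1 k
      have := h k
      rw [show d (b + 1 + 1) k = 0 by omega]; simp
    have h3 := hν.balance (b + 1)
    rw [h2, zero_mul] at h3
    exact (mul_pos hl hb).ne h3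
  obtain ⟨k₀, hk₀, hcheap⟩ := exists_cheapest hμ hserv
  set J := ∑' n, ν n * Q.costRate n (d n) with hJ
  have hJsum : HasSum (fun n => ν n * Q.costRate n (d n)) J := hν.summable_cost.hasSum
  -- idle at `b`, one cheapest server at `b + 1`
  let d' : ℕ → Fin K → ℕ := fun n =>
    if n = b then 0 else if n = b + 1 then Function.update 0 k₀ 1 else d n
  let π : ℕ → ℝ := fun n =>
    if n = b then Q.serviceRate k₀ * ν (b + 1) else Q.arrivalRate * ν n
  have hd'b : d' b = 0 := if_pos rfl
  have hd'b1 : d' (b + 1) = Function.update (0 : Fin K → ℕ) k₀ 1 := by simp [d']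
  have hd'n : ∀ n, n ≠ b → n ≠ b + 1 → d' n = d n := fun n h h' => by simp [d', h, h']
  have hπb : π b = Q.serviceRate k₀ * ν (b + 1) := if_pos rfl
  have hπn : ∀ n, n ≠ b → π n = Q.arrivalRate * ν n := fun n h => if_neg h
  have hr0 : Q.totalRate (0 : Fin K → ℕ) = 0 := by simp [totalRate]
  have hr1 : Q.totalRate (Function.update 0 k₀ 1) = Q.serviceRate k₀ := by
    rw [totalRate_update, hr0]; simp
  have hd' : d' ∈ Q.efficientPolicies := fun n => by
    by_cases h : n = b
    · rw [h, hd'b]; simp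
    by_cases h' : n = b + 1
    · rw [h', hd'b1]
      refine ⟨fun k => ?_, ?_⟩
      · by_cases hk : k = k₀
        · rw [hk, Function.update_self]; exact hk₀
        · rw [Function.update_of_ne hk]; exact Nat.zero_le _
      · rw [Finset.sum_update_of_mem (Finset.mem_univ _)]; simp
    · rw [hd'n n h h']; exact hopt.1 n
  have heq : ∀ n, b + 2 ≤ n → π n * Q.costRate n (d' n) =
      Q.arrivalRate * (ν n * Q.costRate n (d n)) := fun n hn => by
    rw [hπn n (by omega), hd'n n (by omega) (by omega), mul_assoc]
  have hπ : Q.IsReversible d' π :=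
    { nonneg := fun n => by
        by_cases h : n = b
        · rw [h, hπb]; exact mul_nonneg (hμ _).le hb.le
        · rw [hπn n h]; exact mul_nonneg hl.le (hν.nonneg n)
      balance := fun n => by
        by_cases h : n = b
        · rw [h, hd'b1, hr1, hπb, hπn _ (by omega)]; ring
        by_cases h' : n + 1 = b
        · rw [h', hd'b, hr0, hπn n h, hbmin n (by omega)]; simp
        · rw [hd'n _ h' (by omega), hπn n h, hπn _ h']
          linear_combination Q.arrivalRate * hν.balance n
      summable := summable_of_eq_of_le (hν.summable.mul_left Q.arrivalRate) (b + 2)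
        fun n hn => hπn n (by omega)
      summable_cost := summable_of_eq_of_le (hν.summable_cost.mul_left Q.arrivalRate) (b + 2) heq }
  have hex := hopt.excess_nonneg hl hμ hν h1 hb hd' hπ
    (by rw [hπn _ (by omega)]; exact mul_pos hl hb)
  rw [← hJ] at hex
  have hzero : HasSum (fun n => Q.arrivalRate * (ν n * (Q.costRate n (d n) - J))) 0 := by
    have := (hJsum.sub (h1.mul_right J)).mul_left Q.arrivalRate
    simpa [mul_sub] using this
  have htot := hasSum_of_eq_of_le (g' := fun n => π n * (Q.costRate n (d' n) - J)) hzero (b + 2)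
    fun n hn => by rw [hπn n (by omega), hd'n n (by omega) (by omega), mul_assoc]
  rw [htot.tsum_eq, Finset.sum_range_succ, Finset.sum_range_succ, Finset.sum_eq_zero, hπb,
    hπn (b + 1) (by omega), hd'b, hd'b1, costRate_update, hdb, hbmin b (by omega)] at hex
  rotate_left
  · intro n hn
    have hn := Finset.mem_range.1 hn
    rw [hπn n (by omega), hbmin n (by omega)]; simp
  have hcb : Q.costRate b 0 = Q.holdingCost b := by simp [costRate]
  -- Only the terms `b` and `b + 1` of the excess differ from those of `d` scaled by the arrival
  -- rate, and the latter sum to zero.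
  have hup : Q.serviceRate k₀ * J ≤
      Q.serviceRate k₀ * Q.holdingCost b + Q.arrivalRate * Q.operatingCost k₀ := by
    have h3 : 0 ≤ ν (b + 1) * (Q.serviceRate k₀ * Q.holdingCost b +
        Q.arrivalRate * Q.operatingCost k₀ - Q.serviceRate k₀ * J) := by
      rw [hcb] at hex
      simp only [Pi.zero_apply, Nat.cast_zero, Nat.cast_one] at hex
      linarith
    linarith [nonneg_of_mul_nonneg_right h3 hb]
  -- the cost of `d` exceeds the cost of cheapest service plus the least holding cost
  obtain ⟨N, hN, hbN⟩ := ((hinf.eventually_gt_atTop (Q.holdingCost b)).and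
    (eventually_ge_atTop (b + 1))).exists
  have hlow := ((hJsum.sub (h1.mul_right (Q.holdingCost b))).sub
    ((hasSum_totalRate hopt.1 hν h1).mul_left (Q.operatingCost k₀ / Q.serviceRate k₀)))
  have hterm : ∀ n, ν n * (Q.holdingCost n - Q.holdingCost b) ≤
      ν n * Q.costRate n (d n) - ν n * Q.holdingCost b -
        Q.operatingCost k₀ / Q.serviceRate k₀ * (Q.totalRate (d n) * ν n) := fun n => by
    have h4 := mul_le_mul_of_nonneg_left (hcheap (d n) (hopt.1 n).1) (hν.nonneg n)
    rw [costRate]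
    linarith
  -- The strictly positive term at `N` makes the lower bound on `J` strict, which contradicts `hup`.
  have hpos := (mul_pos (balance_pos hl hν.nonneg hν.balance hbN hb) (sub_pos.2 hN)).trans_le
    ((hterm N).trans (le_hasSum hlow N fun n _ => (hterm n).trans' ?_))
  · have h5 : Q.serviceRate k₀ * (Q.operatingCost k₀ / Q.serviceRate k₀) = Q.operatingCost k₀ :=
      mul_div_cancel₀ _ (hμ k₀).ne'
    have h6 := mul_pos (hμ k₀) hpos
    have h7 : Q.serviceRate k₀ * (J - 1 * Q.holdingCost b -
        Q.operatingCost k₀ / Q.serviceRate k₀ * Q.arrivalRate) = Q.serviceRate k₀ * J -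
        Q.serviceRate k₀ * Q.holdingCost b - Q.operatingCost k₀ * Q.arrivalRate := by
      linear_combination -Q.arrivalRate * h5
    linarith
  · rcases lt_or_ge n b with h | h
    · rw [hbmin n (by omega), zero_mul]
    · exact mul_nonneg (hν.nonneg n) (sub_nonneg.2 (hm h))

/-! ### Poisson equation, Bellman inequality and the exchange argument. -/

/-- The relative value differences `g n - g (n - 1)` of the policy `d` with stationary
distribution `ν`, where `g` solves the Poisson equation. -/
noncomputable def valueDiff (Q : GroupServerQueue K) (d : ℕ → Fin K → ℕ) (ν : ℕ → ℝ) (n : ℕ) : ℝ :=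
  (∑ j ∈ Finset.range n, ν j * (∑' n, ν n * Q.costRate n (d n) - Q.costRate j (d j))) /
    (Q.totalRate (d n) * ν n)

lemma totalRate_mul_valueDiff (hl : 0 < Q.arrivalRate) (hν : Q.IsReversible d ν)
    (hpos : ∀ n, 0 < ν n) (n : ℕ) : Q.totalRate (d n) * ν n * Q.valueDiff d ν n =
      ∑ j ∈ Finset.range n, ν j * (∑' n, ν n * Q.costRate n (d n) - Q.costRate j (d j)) := by
  rcases n with _ | n
  · simp [valueDiff]
  · rw [valueDiff, mul_div_cancel₀]
    rw [hν.balance]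
    exact (mul_pos hl (hpos n)).ne'

/-- This is the Poisson equation in difference form; it comes from adding one term to the defining
sum and cancelling `ν n`. -/
lemma arrivalRate_mul_valueDiff (hl : 0 < Q.arrivalRate) (hν : Q.IsReversible d ν)
    (hpos : ∀ n, 0 < ν n) (n : ℕ) : Q.arrivalRate * Q.valueDiff d ν (n + 1) =
      ∑' n, ν n * Q.costRate n (d n) - Q.costRate n (d n) +
        Q.totalRate (d n) * Q.valueDiff d ν n := by
  have h1 := totalRate_mul_valueDiff hl hν hpos (n + 1)
  rw [Finset.sum_range_succ, ← totalRate_mul_valueDiff hl hν hpos n, hν.balance] at h1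
  refine mul_left_cancel₀ (hpos n).ne' ?_
  linear_combination h1

/-- The `ν`-weighted deviations of the cost from its mean sum to zero. Those from `n` on are
nonnegative, so those before `n` have nonpositive sum. -/
lemma valueDiff_nonneg (hl : 0 < Q.arrivalRate) (hc : ∀ k, 0 ≤ Q.operatingCost k)
    (hm : Monotone Q.holdingCost) (hν : Q.IsReversible d ν)
    (h1 : HasSum ν 1) (hpos : ∀ n, 0 < ν n) {n : ℕ}
    (hn : ∑' n, ν n * Q.costRate n (d n) ≤ Q.holdingCost n) : 0 ≤ Q.valueDiff d ν n := by
  rcases n with _ | n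
  · simp [valueDiff]
  have h2 : HasSum (fun j => ν j * (Q.costRate j (d j) - ∑' n, ν n * Q.costRate n (d n))) 0 := by
    have := hν.summable_cost.hasSum.sub (h1.mul_right (∑' n, ν n * Q.costRate n (d n)))
    simpa [mul_sub] using this
  have h3 := sum_le_hasSum (Finset.range (n + 1)) (fun j hj => mul_nonneg (hν.nonneg j)
    (sub_nonneg.2 (hn.trans ((hm (by simpa using hj)).trans
      (holdingCost_le_costRate hc j (d j)))))) h2
  refine div_nonneg ?_ (by rw [hν.balance]; exact (mul_pos hl (hpos n)).le)
  rw [← neg_nonpos, ← Finset.sum_neg_distrib]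
  exact (Finset.sum_le_sum fun j _ => by linarith).trans h3

/-- The optimality equation at the states `n ≥ 1`: the action of an optimal policy minimizes the
right-hand side of the Bellman equation. -/
theorem IsOptimal.action_le (hl : 0 < Q.arrivalRate) (hμ : ∀ k, 0 < Q.serviceRate k)
    (hopt : Q.IsOptimal d) (hν : Q.IsReversible d ν) (h1 : HasSum ν 1) (hpos : ∀ n, 0 < ν n)
    {n : ℕ} (hn : 0 < n) {m : Fin K → ℕ} (hmM : ∀ k, m k ≤ Q.servers k) (hmn : ∑ k, m k ≤ n) :
    Q.costRate n (d n) - Q.totalRate (d n) * Q.valueDiff d ν n ≤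
      Q.costRate n m - Q.totalRate m * Q.valueDiff d ν n := by
  obtain ⟨n, rfl⟩ := Nat.exists_eq_add_of_lt hn
  rw [zero_add] at *
  have hG := totalRate_mul_valueDiff hl hν hpos (n + 1)
  set J := ∑' n, ν n * Q.costRate n (d n) with hJ
  set r := Q.totalRate (d (n + 1))
  have hr0 : 0 < r :=
    (pos_iff_pos_of_mul_pos ((mul_pos hl (hpos n)).trans_eq (hν.balance n).symm)).2 (hpos _)
  let d' : ℕ → Fin K → ℕ := Function.update d (n + 1) m
  -- Only the balance across the cut below `n + 1` changes, so the two sides are rescaled. Without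
  -- division `m = 0` is allowed; then only states from `n + 1` on are charged, hence `n + 1` serves
  -- as initial state.
  let π : ℕ → ℝ := fun j => if j ≤ n then Q.totalRate m * ν j else r * ν j
  have hd'n : d' (n + 1) = m := Function.update_self ..
  have hd'j : ∀ j, j ≠ n + 1 → d' j = d j := fun j hj => Function.update_of_ne hj ..
  have hπ1 : ∀ j, j ≤ n → π j = Q.totalRate m * ν j := fun j hj => if_pos hj
  have hπ2 : ∀ j, n + 1 ≤ j → π j = r * ν j := fun j hj => if_neg (by omega)
  have hd' : d' ∈ Q.efficientPolicies := fun j => by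
    by_cases hj : j = n + 1
    · rw [hj, hd'n]; exact ⟨hmM, hmn⟩
    · rw [hd'j j hj]; exact hopt.1 j
  have hπ : Q.IsReversible d' π :=
    { nonneg := fun j => by
        rcases Nat.lt_or_ge n j with hj | hj
        · rw [hπ2 j hj]; exact mul_nonneg hr0.le (hν.nonneg j)
        · rw [hπ1 j hj]; exact mul_nonneg (totalRate_nonneg hμ m) (hν.nonneg j)
      balance := fun j => by
        rcases lt_trichotomy j n with hj | rfl | hj
        · rw [hπ1 _ hj, hπ1 _ hj.le, hd'j _ (by omega)]
          linear_combination Q.totalRate m * hν.balance j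
        · rw [hπ1 _ le_rfl, hπ2 _ le_rfl, hd'n]
          linear_combination Q.totalRate m * hν.balance j
        · rw [hπ2 _ (by omega), hπ2 _ hj, hd'j _ (by omega)]
          linear_combination r * hν.balance j
      summable := summable_of_eq_of_le (hν.summable.mul_left r) (n + 1) hπ2
      summable_cost := summable_of_eq_of_le (hν.summable_cost.mul_left r) (n + 2) fun j hj => by
        rw [hπ2 j (by omega), hd'j j (by omega), mul_assoc] }
  have hex := hopt.excess_nonneg hl hμ hν h1 (hpos (n + 1)) hd' hπ
    (by rw [hπ2 _ le_rfl]; exact mul_pos hr0 (hpos _))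
  rw [← hJ] at hex
  have hzero : HasSum (fun j => r * (ν j * (Q.costRate j (d j) - J))) 0 := by
    have := (hν.summable_cost.hasSum.sub (h1.mul_right J)).mul_left r
    simpa [mul_sub, ← hJ] using this
  have htot := hasSum_of_eq_of_le (g' := fun j => π j * (Q.costRate j (d' j) - J)) hzero (n + 2)
    fun j hj => by rw [hπ2 j (by omega), hd'j j (by omega), mul_assoc]
  have hlower : ∑ j ∈ Finset.range (n + 1),
      (π j * (Q.costRate j (d' j) - J) - r * (ν j * (Q.costRate j (d j) - J))) =
      (r - Q.totalRate m) * ∑ j ∈ Finset.range (n + 1), ν j * (J - Q.costRate j (d j)) := by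
    rw [Finset.mul_sum]
    refine Finset.sum_congr rfl fun j hj => ?_
    have hj := Finset.mem_range.1 hj
    rw [hπ1 j (by omega), hd'j j (by omega)]
    ring
  rw [htot.tsum_eq, Finset.sum_range_succ, hlower, ← hG, hπ2 _ le_rfl, hd'n] at hex
  have h8 : 0 ≤ (r * ν (n + 1)) *
      ((Q.costRate (n + 1) m - Q.totalRate m * Q.valueDiff d ν (n + 1)) - (Q.costRate (n + 1) (d (n + 1)) - r * Q.valueDiff d ν (n + 1))) := by
    linarith
  exact sub_nonneg.1 (nonneg_of_mul_nonneg_right h8 (mul_pos hr0 (hpos _)))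

/-- The value differences are strictly increasing on the states that can occupy all servers. -/
theorem IsOptimal.valueDiff_lt_succ (hl : 0 < Q.arrivalRate) (hμ : ∀ k, 0 < Q.serviceRate k)
    (hc : ∀ k, 0 ≤ Q.operatingCost k)
    (hm : Monotone Q.holdingCost) (hinf : Tendsto Q.holdingCost atTop atTop)
    (hopt : Q.IsOptimal d) (hν : Q.IsReversible d ν) (h1 : HasSum ν 1) (hpos : ∀ n, 0 < ν n)
    {n : ℕ} (hn : 0 < n) (hserv : ∑ k, Q.servers k ≤ n) :
    Q.valueDiff d ν n < Q.valueDiff d ν (n + 1) := by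
  by_contra! hle
  -- Subtract the Poisson equations at `j + 1` and `j`, after testing the Bellman inequality at `j`
  -- with the action `d (j + 1)`. That action is feasible there because `j` customers can occupy all
  -- servers.
  have hstep : ∀ j, n ≤ j → Q.valueDiff d ν (j + 1) ≤ Q.valueDiff d ν j →
      Q.arrivalRate * (Q.valueDiff d ν (j + 2) - Q.valueDiff d ν (j + 1)) ≤
        Q.holdingCost j - Q.holdingCost (j + 1) := fun j hj h => by
    have hj1 := arrivalRate_mul_valueDiff hl hν hpos (j + 1)
    have hj0 := arrivalRate_mul_valueDiff hl hν hpos j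
    have hopt' := hopt.action_le hl hμ hν h1 hpos (hn.trans_le hj) (hopt.1 (j + 1)).1
      ((Finset.sum_le_sum fun k _ => (hopt.1 (j + 1)).1 k).trans (hserv.trans hj))
    have hr := mul_le_mul_of_nonneg_left h (totalRate_nonneg hμ (d (j + 1)))
    have hcr : Q.costRate j (d (j + 1)) =
        Q.costRate (j + 1) (d (j + 1)) + Q.holdingCost j - Q.holdingCost (j + 1) := by
      simp only [costRate]; ring
    rw [hcr] at hopt'
    linarith
  have hdecr : ∀ j, n ≤ j → Q.valueDiff d ν (j + 1) ≤ Q.valueDiff d ν j ∧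
      Q.arrivalRate * Q.valueDiff d ν (j + 1) ≤
        Q.arrivalRate * Q.valueDiff d ν (n + 1) + Q.holdingCost n - Q.holdingCost j :=
    fun j hj => by
      induction j, hj using Nat.le_induction with
      | base => exact ⟨hle, by linarith⟩
      | succ j hj ih =>
        have h2 := hstep j hj ih.1
        refine ⟨?_, by linarith [ih.2]⟩
        refine le_of_mul_le_mul_left ?_ hl
        linarith [hm (Nat.le_succ j)]
  -- Choose `j` so large that the bound in `hdecr` is negative while `valueDiff_nonneg` applies at
  -- `j + 1`.
  obtain ⟨j, hj1, hj2, hj3⟩ := ((hinf.eventually_gt_atTop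
    (Q.arrivalRate * Q.valueDiff d ν (n + 1) + Q.holdingCost n)).and
    ((hinf.eventually_ge_atTop (∑' n, ν n * Q.costRate n (d n))).and
      (eventually_ge_atTop n))).exists
  have h3 := valueDiff_nonneg hl hc hm hν h1 hpos (hj2.trans (hm (Nat.le_succ j)))
  linarith [(hdecr j hj3).2, mul_nonneg hl.le h3]

/-- An optimal policy that turns on all servers at `N` does so at all larger states. -/
theorem IsOptimal.eq_servers (hl : 0 < Q.arrivalRate) (hμ : ∀ k, 0 < Q.serviceRate k)
    (hc : ∀ k, 0 ≤ Q.operatingCost k)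
    (hm : Monotone Q.holdingCost) (hinf : Tendsto Q.holdingCost atTop atTop)
    (hopt : Q.IsOptimal d) {N : ℕ} (hN : ∀ k, d N k = Q.servers k) {n : ℕ} (hn : N ≤ n)
    (k : Fin K) : d n k = Q.servers k := by
  refine le_antisymm ((hopt.1 n).1 k) (not_lt.1 fun hlt => ?_)
  -- The full action is feasible at `N`, so every action within the server limits is feasible from
  -- `N` on.
  have hserv : ∑ k, Q.servers k ≤ N := by
    simpa only [hN] using (hopt.1 N).2
  have hk : Q.servers k ≤ N :=
    (Finset.single_le_sum (f := Q.servers) (fun _ _ => Nat.zero_le _) (Finset.mem_univ k)).trans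
      hserv
  have hN0 : 0 < N := by omega
  have hNn : N < n := hn.lt_of_ne (by rintro rfl; exact hlt.ne (hN k))
  obtain ⟨η, hη, -⟩ := hopt.2 0
  obtain ⟨ν, hν, h1⟩ := exists_isReversible hl hμ hc hm hinf hopt.1 hη
  have hpos := hopt.pos_stationary hl hμ hm hinf hν h1
  have hmono : Q.valueDiff d ν N < Q.valueDiff d ν n := by
    refine Nat.rel_of_forall_rel_succ_of_le_of_lt (· < ·) (a := N) (fun j hj => ?_) le_rfl hNn
    exact hopt.valueDiff_lt_succ hl hμ hc hm hinf hν h1 hpos (hN0.trans_le hj) (hserv.trans hj)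
  have hbox : ∀ (a : Fin K → ℕ) x, (∀ j, a j ≤ Q.servers j) → x ≤ Q.servers k →
      ∀ j, Function.update a k x j ≤ Q.servers j := fun a x ha hx j => by
    by_cases hj : j = k
    · rw [hj, Function.update_self]; exact hx
    · rw [Function.update_of_ne hj]; exact ha j
  -- Switching one server of group `k` off at `N`, and below one more on at `n`, yields `μ_k * G n ≤
  -- c_k ≤ μ_k * G N`.
  have hoff := hopt.action_le hl hμ hν h1 hpos hN0
    (hbox (d N) (Q.servers k - 1) (hopt.1 N).1 (Nat.sub_le _ _))
    ((Finset.sum_le_sum fun j _ => hbox _ _ (hopt.1 N).1 (Nat.sub_le _ _) j).trans hserv)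
  have hon := hopt.action_le hl hμ hν h1 hpos (hN0.trans hNn)
    (hbox (d n) (d n k + 1) (hopt.1 n).1 hlt)
    ((Finset.sum_le_sum fun j _ => hbox _ _ (hopt.1 n).1 hlt j).trans (hserv.trans hn))
  rw [totalRate_update, costRate_update, hN k, Nat.cast_sub (by omega)] at hoff
  rw [totalRate_update, costRate_update] at hon
  push_cast at hoff hon
  have := mul_lt_mul_of_pos_left hmono (hμ k)
  linarith

end Improvement

/-! ### Finiteness of the truncated class and the main theorem. -/

section Truncation

lemma finite_truncatedPolicies (N : ℕ) : (Q.truncatedPolicies N).Finite := by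
  have hfin : Finite (Fin N → (k : Fin K) → Fin (Q.servers k + 1)) := inferInstance
  let φ : Q.truncatedPolicies N → Fin N → (k : Fin K) → Fin (Q.servers k + 1) :=
    fun d n k => ⟨d.1 n k, Nat.lt_succ_of_le ((d.2.1 n).1 k)⟩
  refine @Set.toFinite _ _ (Finite.of_injective φ fun d d' h => ?_)
  refine Subtype.ext (funext fun n => funext fun k => ?_)
  rcases lt_or_ge n N with hn | hn
  · exact congrArg Fin.val (congrFun (congrFun h ⟨n, hn⟩) k)
  · rw [d.2.2 n hn k, d'.2.2 n hn k]

end Truncation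

end GroupServerQueue

theorem corollary1 {K : ℕ} (Q : GroupServerQueue K)
    (h_arrival : 0 < Q.arrivalRate)
    (h_service : ∀ k, 0 < Q.serviceRate k)
    (h_cost : ∀ k, 0 ≤ Q.operatingCost k)
    (h_mono : Monotone Q.holdingCost)
    (h_convex : ∀ n, 2 * Q.holdingCost (n + 1) ≤ Q.holdingCost n + Q.holdingCost (n + 2))
    (h_infty : Tendsto Q.holdingCost atTop atTop)
    (dstar : ℕ → Fin K → ℕ) (h_opt : Q.IsOptimal dstar)
    (nbar : ℕ) (h_full : ∀ k, dstar nbar k = Q.servers k) :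
    (∀ n, nbar ≤ n → ∀ k, dstar n k = Q.servers k) ∧
      (Q.truncatedPolicies nbar).Finite ∧
      ∀ d, Q.IsOptimalIn (Q.truncatedPolicies nbar) d → Q.IsOptimal d := by
  have htail : ∀ n, nbar ≤ n → ∀ k, dstar n k = Q.servers k := fun n hn =>
    h_opt.eq_servers h_arrival h_service h_cost h_mono h_infty h_full hn
  refine ⟨htail, GroupServerQueue.finite_truncatedPolicies nbar, fun d hd => ⟨hd.1.1, fun n₀ => ?_⟩⟩
  obtain ⟨η, hη, hmin⟩ := hd.2 n₀
  obtain ⟨ηstar, hηstar, hminstar⟩ := h_opt.2 n₀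
  -- By `htail`, `dstar` competes in the truncated class, so `d` costs no more than `dstar`.
  exact ⟨η, hη, fun d' hd' η' hη' =>
    (hmin dstar ⟨h_opt.1, htail⟩ ηstar hηstar).trans (hminstar d' hd' η' hη')⟩
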